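/- Let $k$ be a field of characteristic zero. For a sequence $s=(s_1,\dots,s_4)$ of positive integers let $P_s\subset R=k[x_1,x_2,x_3,x_4]$ be the kernel of the $k$-algebra homomorphism $R\to k[t]$, $x_i\mapsto t^{s_i}$ (the defining ideal of the monomial curve of $s$), and let $\mu(I)$ denote the minimal number of generators of an ideal $I$. A critical binomial with respect to $x_i$ is a binomial $x_i^{\alpha}-\prod_{l\ne i}x_l^{e_l}\in P_s$ where $\alpha$ is the least positive integer such that $\alpha s_i$ lies in the semigroup $\sum_{l\neq i}\mathbb N s_l$ (with $0\in\mathbb N$). Let $a,b,c,j$ be positive integers, let $n,t,p$ be non-negative integers, and let $P_j$ be the ideal $P_s$ of the sequence $s=(j,\,a+j,\,a+b+j,\,a+b+c+j)$. Put $d=\gcd(a,b)$ and $d'=\gcd(b,c)$. (i) Let $j=(a+b+c)n$. If $c=p(a+b)$, then $$P_j=\langle x_1^{n+1}-x_4^{n},\; x_3^{p+1}-x_1^{p}x_4,\; x_2^{(a+b)/d}-x_1^{b/d}x_3^{a/d}\rangle\quad\text{and}\quad \mu(P_j)=3.$$ If $a=p(b+c)$, then $$P_j=\langle x_1^{n+1}-x_4^{n},\;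 x_2^{p+1}-x_1x_4^{p},\; x_3^{(b+c)/d'}-x_2^{c/d'}x_4^{b/d'}\rangle\quad\text{and}\quad \mu(P_j)=3.$$ (ii) Let $c=p(a+b)$, $1\le t\le p$, $j=(a+b+c)n+(a+b)t$, and suppose $n\ge 1$ and $n+t\ge p$. Then $\mu(P_j)=4$, and $P_j$ is generated by $$f_1=x_1^{n+t+1}-x_3^{t}x_4^{n},\quad f_2=x_2^{(a+b)/d}-x_1^{b/d}x_3^{a/d},\quad f_3=x_3^{p+1}-x_1^{p}x_4,\quad f_4=x_4^{n+1}-x_1^{n+t-p+1}x_3^{p-t+1},$$ where $f_i$ is a critical binomial with respect to $x_i$ for $i=1,2,3,4$. (iii) Let $a=p(b+c)$, $1\le t\le p$, $j=(a+b+c)n+(b+c)t$, and suppose $n+t>p$. Then $\mu(P_j)=4$, and $P_j$ is generated by $$f_1=x_1^{n+2}-x_2^{p+1-t}x_4^{n+t-p},\quad f_2=x_2^{p+1}-x_1x_4^{p},\quad f_3=x_3^{(b+c)/d'}-x_2^{c/d'}x_4^{b/d'},\quad f_4=x_4^{n+t}-x_1^{n+1}x_2^{t},$$ where $f_i$ is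 a critical binomial with respect to $x_i$ for $i=1,2,3,4$. -/

import Mathlib

/-- The homomorphism of `k`-algebras `φ : k[x₁, …, xₘ] → k[t]` with `xᵢ ↦ t ^ (s i)`. -/
noncomputable def monomialCurveHom (k : Type*) [Field k] {m : ℕ} (s : Fin m → ℕ) :
    MvPolynomial (Fin m) k →ₐ[k] Polynomial k :=
  MvPolynomial.aeval fun i => (Polynomial.X : Polynomial k) ^ s i

/-- The defining ideal `P_s = Ker φ` of the monomial curve attached to the sequence `s`. -/
noncomputable def definingIdeal (k : Type*) [Field k] {m : ℕ} (s : Fin m → ℕ) :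
    Ideal (MvPolynomial (Fin m) k) :=
  RingHom.ker (monomialCurveHom k s)

/-- The translated sequence `(j, a + j, a + b + j, a + b + c + j)`. -/
def translatedSeq (a b c j : ℕ) : Fin 4 → ℕ :=
  ![j, a + j, a + b + j, a + b + c + j]

/-- The minimal number of generators `μ(I)`: the least cardinality of a generating set
of the (finitely generated) ideal `I`. -/
noncomputable def minGenerators {R : Type*} [CommRing R] (I : Ideal R) : ℕ :=
  Submodule.spanFinrank I

/-- `f` is a critical binomial with respect to `xᵢ`: it lies in `P_s` and has the form
`xᵢ ^ α - ∏_{l ≠ i} x_l ^ (e l)`, where `α` is the least positive integer such that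
`α * s i` lies in the numerical semigroup (with zero) generated by the `s l`, `l ≠ i`. -/
def IsCriticalBinomial (k : Type*) [Field k] {m : ℕ} (s : Fin m → ℕ) (i : Fin m)
    (f : MvPolynomial (Fin m) k) : Prop :=
  f ∈ definingIdeal k s ∧
    ∃ (α : ℕ) (e : Fin m → ℕ),
      f = MvPolynomial.X i ^ α - ∏ l ∈ Finset.univ.erase i, MvPolynomial.X l ^ e l ∧
      IsLeast {q : ℕ | 0 < q ∧ q * s i ∈ AddSubmonoid.closure (s '' {l | l ≠ i})} α

open MvPolynomial

/-!
The curve ideal `P_s` is spanned by differences of monomials of equal weight `∑ e_i s_i`. So some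
binomials of `P_s` generate it as soon as every monomial can be rewritten, with the binomials as
rules, to a standard one (divisible by none of the leading monomials) and distinct standard
monomials have distinct weights.

Let `c = p (a + b)`; the other case is similar, with `x_3` in the role of `x_2`. After division by
`d = gcd(a, b)`, all of `s_1, s_3, s_4` are multiples of `(a + b) / d`, so the weight modulo
`(a + b) / d` determines the exponent of `x_2`. If `j` is a multiple of `a + b + c`, the same
argument modulo `p + 1` and then modulo `n + 1` determines the remaining exponents. Otherwise, two
standard monomials of equal weight have exponents that differ, in two of the variables, by a vector
of a plane lattice, while these exponents lie in an L-shaped fundamental domain of it.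

On the `x_i`-axis each generator restricts to `x_i ^ α_i` or to zero, one generator to each power.
So no element of `P_s` has a lower power of `x_i` as a term, which makes the generators critical,
and the coefficients of these powers show that no smaller set generates.
-/

section Monomials

open scoped Matrix

variable {σ R : Type*} [Fintype σ]

/-- The monomial `∏ l, x_l ^ e l` with exponent vector `e`, taken as a plain function so that
concrete exponents can be written `![e₁, e₂, …]`. -/
noncomputable def expMonomial (R : Type*) [CommSemiring R] (e : σ → ℕ) : MvPolynomial σ R :=
  ∏ l, X l ^ e l

lemma monomial_one_eq_expMonomial [CommSemiring R] (e : σ →₀ ℕ) :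
    monomial e (1 : R) = expMonomial R e := by
  rw [monomial_eq, C_1, one_mul, Finsupp.prod_fintype _ _ fun _ => pow_zero _, expMonomial]

lemma expMonomial_add [CommSemiring R] (e e' : σ → ℕ) :
    expMonomial R (e + e') = expMonomial R e * expMonomial R e' := by
  simp only [expMonomial, Pi.add_apply, pow_add, Finset.prod_mul_distrib]

lemma expMonomial_single [CommSemiring R] [DecidableEq σ] (i : σ) (q : ℕ) :
    expMonomial R (Pi.single i q) = X i ^ q := by
  rw [expMonomial, Finset.prod_eq_single i (fun l _ hl => by rw [Pi.single_eq_of_ne hl, pow_zero])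
    (by simp), Pi.single_eq_same]

lemma expMonomial_fin_four [CommSemiring R] (e : Fin 4 → ℕ) :
    expMonomial R e = X 0 ^ e 0 * X 1 ^ e 1 * X 2 ^ e 2 * X 3 ^ e 3 :=
  Fin.prod_univ_four _

/-- The exponents of the standard monomials: those divisible by none of the monomials with
exponents `u i`. -/
def standardExponents {ι σ : Type*} (u : ι → σ → ℕ) : Set (σ → ℕ) :=
  {e | ∀ i, ¬ u i ≤ e}

/-- Rewriting `x ^ u i` to `x ^ v i` terminates, because every step lowers the `w`-weight. -/
lemma exists_mem_standardExponents_sub_mem [CommRing R] {ι : Type*} {I : Ideal (MvPolynomial σ R)}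
    {u v : ι → σ → ℕ} (huv : ∀ i, expMonomial R (u i) - expMonomial R (v i) ∈ I)
    {w : σ → ℕ} (hw : ∀ i, v i ⬝ᵥ w < u i ⬝ᵥ w) (e : σ → ℕ) :
    ∃ e' ∈ standardExponents u, expMonomial R e - expMonomial R e' ∈ I := by
  induction h : e ⬝ᵥ w using Nat.strong_induction_on generalizing e with
  | _ N ih =>
    by_cases he : e ∈ standardExponents u
    · exact ⟨e, he, by rw [sub_self]; exact I.zero_mem⟩
    obtain ⟨i, hi⟩ : ∃ i, u i ≤ e := by
      simpa only [standardExponents, Set.mem_ofPred_eq, not_forall, not_not] using he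
    obtain ⟨r, rfl⟩ := exists_add_of_le hi
    have hlt : (v i + r) ⬝ᵥ w < N := by
      rw [← h, add_dotProduct, add_dotProduct]
      exact Nat.add_lt_add_right (hw i) _
    obtain ⟨e', he', hmem⟩ := ih _ hlt (v i + r) rfl
    have hstep : expMonomial R (u i + r) - expMonomial R (v i + r) ∈ I := by
      rw [expMonomial_add, expMonomial_add, ← sub_mul]
      exact I.mul_mem_right _ (huv i)
    exact ⟨e', he', by simpa only [sub_add_sub_cancel] using I.add_mem hstep hmem⟩

end Monomials

section DefiningIdeal

open scoped Matrix

variable {k : Type*} [Field k] {m : ℕ} {s : Fin m → ℕ}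

lemma monomialCurveHom_expMonomial (e : Fin m → ℕ) :
    monomialCurveHom k s (expMonomial k e) = Polynomial.X ^ (e ⬝ᵥ s) := by
  simp only [monomialCurveHom, expMonomial, map_prod, map_pow, aeval_X, ← pow_mul,
    Finset.prod_pow_eq_pow_sum, dotProduct, mul_comm]

lemma expMonomial_sub_mem_definingIdeal_iff {u v : Fin m → ℕ} :
    expMonomial k u - expMonomial k v ∈ definingIdeal k s ↔ u ⬝ᵥ s = v ⬝ᵥ s := by
  rw [definingIdeal, RingHom.sub_mem_ker_iff, monomialCurveHom_expMonomial,
    monomialCurveHom_expMonomial,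
    pow_inj_of_not_isUnit Polynomial.not_isUnit_X Polynomial.X_ne_zero]

/-- `P_s` is spanned by binomials: if `I` identifies monomials of equal weight, then
`t ^ N ↦ [x ^ e]`, for any `e` of weight `N`, inverts `φ` modulo `I`. -/
lemma definingIdeal_le {I : Ideal (MvPolynomial (Fin m) k)}
    (hI : ∀ u v : Fin m → ℕ, u ⬝ᵥ s = v ⬝ᵥ s → expMonomial k u - expMonomial k v ∈ I) :
    definingIdeal k s ≤ I := by
  have hfactor : (fun e => Ideal.Quotient.mkₐ k I (expMonomial k e)).FactorsThrough (· ⬝ᵥ s) :=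
    fun u v h => Ideal.Quotient.eq.2 (hI u v h)
  let ψ : Polynomial k →ₗ[k] MvPolynomial (Fin m) k ⧸ I :=
    (Polynomial.basisMonomials k).constr k
      (Function.extend (· ⬝ᵥ s) (fun e => Ideal.Quotient.mkₐ k I (expMonomial k e)) 0)
  have hinv : ψ ∘ₗ (monomialCurveHom k s).toLinearMap =
      (Ideal.Quotient.mkₐ k I).toLinearMap := by
    refine (MvPolynomial.basisMonomials (Fin m) k).ext fun e => ?_
    simp only [coe_basisMonomials, monomial_one_eq_expMonomial, LinearMap.comp_apply,
      AlgHom.toLinearMap_apply, monomialCurveHom_expMonomial, Polynomial.X_pow_eq_monomial]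
    exact ((Polynomial.basisMonomials k).constr_basis k _ _).trans (hfactor.extend_apply _ _)
  intro g hg
  have hψg := LinearMap.congr_fun hinv g
  rw [LinearMap.comp_apply, AlgHom.toLinearMap_apply, (RingHom.mem_ker).1 hg, map_zero] at hψg
  exact Ideal.Quotient.eq_zero_iff_mem.1 hψg.symm

theorem definingIdeal_eq_span_range_of_injOn {ι : Type*} {f : ι → MvPolynomial (Fin m) k}
    {u v : ι → Fin m → ℕ}
    (hf : ∀ i, f i = expMonomial k (u i) - expMonomial k (v i) ∨
      f i = expMonomial k (v i) - expMonomial k (u i))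
    (hs : ∀ i, u i ⬝ᵥ s = v i ⬝ᵥ s) {w : Fin m → ℕ} (hw : ∀ i, v i ⬝ᵥ w < u i ⬝ᵥ w)
    (hinj : Set.InjOn (· ⬝ᵥ s) (standardExponents u)) :
    definingIdeal k s = Ideal.span (Set.range f) := by
  have hle : Ideal.span (Set.range f) ≤ definingIdeal k s := by
    rw [Ideal.span_le, Set.range_subset_iff]
    intro i
    rcases hf i with h | h <;> rw [h]
    · exact expMonomial_sub_mem_definingIdeal_iff.2 (hs i)
    · exact expMonomial_sub_mem_definingIdeal_iff.2 (hs i).symm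
  have huv : ∀ i, expMonomial k (u i) - expMonomial k (v i) ∈ Ideal.span (Set.range f) := by
    intro i
    have hi : f i ∈ Ideal.span (Set.range f) := Ideal.subset_span ⟨i, rfl⟩
    rcases hf i with h | h
    · rwa [← h]
    · rwa [sub_mem_comm_iff, ← h]
  refine (definingIdeal_le fun e e' h => ?_).antisymm hle
  obtain ⟨r, hr, her⟩ := exists_mem_standardExponents_sub_mem huv hw e
  obtain ⟨r', hr', her'⟩ := exists_mem_standardExponents_sub_mem huv hw e'
  have hrr' : r ⬝ᵥ s = r' ⬝ᵥ s := by
    rw [← expMonomial_sub_mem_definingIdeal_iff.1 (hle her), h,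
      expMonomial_sub_mem_definingIdeal_iff.1 (hle her')]
  obtain rfl : r = r' := hinj hr hr' hrr'
  simpa only [sub_sub_sub_cancel_right] using Ideal.sub_mem _ her her'

lemma definingIdeal_smul {d : ℕ} (hd : 0 < d) : definingIdeal k (d • s) = definingIdeal k s := by
  have hcomp : monomialCurveHom k (d • s) =
      (Polynomial.expand k d).comp (monomialCurveHom k s) := by
    ext i : 1
    simp only [monomialCurveHom, AlgHom.comp_apply, aeval_X, Pi.smul_apply, smul_eq_mul, map_pow,
      Polynomial.expand_X, pow_mul]
  ext g
  rw [definingIdeal, definingIdeal, RingHom.mem_ker, RingHom.mem_ker, hcomp, AlgHom.comp_apply,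
    Polynomial.expand_eq_zero hd]

end DefiningIdeal

section Axes

variable {σ R : Type*} [DecidableEq σ]

/-- Restriction to the `i`-th coordinate axis: all variables but `x_i` are set to zero. -/
noncomputable def toAxis (R : Type*) [CommSemiring R] (i : σ) :
    MvPolynomial σ R →ₐ[R] Polynomial R :=
  aeval (Pi.single i Polynomial.X)

lemma toAxis_X_self [CommSemiring R] (i : σ) : toAxis R i (X i) = Polynomial.X := by
  rw [toAxis, aeval_X, Pi.single_eq_same]

lemma toAxis_X_of_ne [CommSemiring R] {i l : σ} (h : l ≠ i) : toAxis R i (X l) = 0 := by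
  rw [toAxis, aeval_X, Pi.single_eq_of_ne h]

lemma toAxis_expMonomial_of_ne [CommSemiring R] [Fintype σ] {i l : σ} (hl : l ≠ i) {e : σ → ℕ}
    (he : e l ≠ 0) : toAxis R i (expMonomial R e) = 0 := by
  rw [expMonomial, map_prod]
  refine Finset.prod_eq_zero (Finset.mem_univ l) ?_
  rw [map_pow, toAxis_X_of_ne hl, zero_pow he]

lemma coeff_zero_toAxis [CommSemiring R] (i : σ) (g : MvPolynomial σ R) :
    (toAxis R i g).coeff 0 = constantCoeff g := by
  have hcomp : Polynomial.constantCoeff.comp (toAxis R i : MvPolynomial σ R →+* Polynomial R) =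
      constantCoeff := by
    refine ringHom_ext (fun r => ?_) fun l => ?_
    · simp [toAxis]
    · by_cases h : l = i
      · simp [h, toAxis_X_self]
      · simp [toAxis_X_of_ne h]
  exact RingHom.congr_fun hcomp g

lemma coeff_toAxis_mul [CommSemiring R] {i : σ} {q : ℕ} {g : MvPolynomial σ R}
    (hg : Polynomial.X ^ q ∣ toAxis R i g) (r : MvPolynomial σ R) :
    (toAxis R i (r * g)).coeff q = constantCoeff r * (toAxis R i g).coeff q := by
  obtain ⟨h, hh⟩ := hg
  rw [map_mul, hh, mul_left_comm, Polynomial.coeff_X_pow_mul', Polynomial.coeff_X_pow_mul',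
    if_pos le_rfl, if_pos le_rfl, Nat.sub_self, Polynomial.mul_coeff_zero, coeff_zero_toAxis]

variable [CommRing R]

lemma dvd_toAxis_of_mem_span {S : Set (MvPolynomial σ R)} {i : σ} {h : Polynomial R}
    (hS : ∀ f ∈ S, h ∣ toAxis R i f) {g : MvPolynomial σ R} (hg : g ∈ Ideal.span S) :
    h ∣ toAxis R i g := by
  have hle : Ideal.span S ≤ (Ideal.span {h}).comap (toAxis R i) :=
    Ideal.span_le.2 fun f hf => Ideal.mem_span_singleton.2 (hS f hf)
  exact Ideal.mem_span_singleton.1 (hle hg)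

variable {ι : Type*} {I : Ideal (MvPolynomial σ R)} {x : ι → σ} {α : ι → ℕ}

/-- The coefficients of the pure powers `x_{x i} ^ α i`, on an ideal without lower powers of the
same variables. Such an ideal then sees a multiplier only through its constant coefficient. -/
noncomputable def axisCoeff (h : ∀ g ∈ I, ∀ i, Polynomial.X ^ α i ∣ toAxis R (x i) g) :
    I →ₛₗ[(constantCoeff : MvPolynomial σ R →+* R)] (ι → R) where
  toFun g i := (toAxis R (x i) g).coeff (α i)
  map_add' g g' := by
    ext i
    simp only [Submodule.coe_add, map_add, Polynomial.coeff_add, Pi.add_apply]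
  map_smul' r g := by
    ext i
    exact coeff_toAxis_mul (h g g.2 i) r

theorem card_le_minGenerators [Nontrivial R] [Fintype ι] [DecidableEq ι] (hI : I.FG)
    (h : ∀ g ∈ I, ∀ i, Polynomial.X ^ α i ∣ toAxis R (x i) g) {f : ι → MvPolynomial σ R}
    (hfI : ∀ j, f j ∈ I)
    (hf : ∀ i j, (toAxis R (x i) (f j)).coeff (α i) = if i = j then 1 else 0) :
    Fintype.card ι ≤ minGenerators I := by
  have : RingHomSurjective (constantCoeff : MvPolynomial σ R →+* R) :=
    ⟨fun r => ⟨C r, constantCoeff_C σ r⟩⟩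
  have hsurj : (⊤ : Submodule _ I).map (axisCoeff h) = ⊤ := by
    rw [eq_top_iff, ← (Pi.basisFun R ι).span_eq, Submodule.span_le, Set.range_subset_iff]
    refine fun j => ⟨⟨f j, hfI j⟩, Submodule.mem_top, funext fun i => ?_⟩
    rw [Pi.basisFun_apply, Pi.single_apply]
    exact hf i j
  calc Fintype.card ι = (⊤ : Submodule R (ι → R)).spanFinrank := by
        rw [← Module.finrank_eq_spanFinrank_of_free, Module.finrank_fintype_fun_eq_card]
    _ ≤ (⊤ : Submodule _ I).spanFinrank := by
        rw [← hsurj]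
        exact Submodule.spanFinrank_map_le_of_fg _ (Module.Finite.iff_fg.2 hI).1
    _ = minGenerators I := Submodule.spanFinrank_top I

end Axes

section AxialBinomials

variable {σ ι R : Type*} [Fintype σ] [CommRing R] {x : ι → σ} {α : ι → ℕ} {e : ι → σ → ℕ}

/-- The binomials `x_{x j} ^ α j - ∏ l, x_l ^ e j l`, the shape of all the generators below: a pure
power against a monomial, which is usually a mixed one. -/
noncomputable def axialBinomial (R : Type*) [CommRing R] (x : ι → σ) (α : ι → ℕ) (e : ι → σ → ℕ)
    (j : ι) : MvPolynomial σ R :=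
  X (x j) ^ α j - expMonomial R (e j)

lemma toAxis_axialBinomial [DecidableEq σ] [DecidableEq ι] (hx : Function.Injective x)
    (hα : ∀ j, α j ≠ 0) (he : ∀ i j, ∃ l, l ≠ x i ∧ e j l ≠ 0) (i j : ι) :
    toAxis R (x i) (axialBinomial R x α e j) = if i = j then Polynomial.X ^ α i else 0 := by
  obtain ⟨l, hl, hel⟩ := he i j
  rw [axialBinomial, map_sub, map_pow, toAxis_expMonomial_of_ne hl hel, sub_zero]
  split_ifs with h
  · rw [h, toAxis_X_self]
  · rw [toAxis_X_of_ne fun hji => h (hx hji).symm, zero_pow (hα j)]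

lemma X_pow_dvd_toAxis_of_mem_span_axialBinomial [DecidableEq σ] (hx : Function.Injective x)
    (hα : ∀ j, α j ≠ 0) (he : ∀ i j, ∃ l, l ≠ x i ∧ e j l ≠ 0) {g : MvPolynomial σ R}
    (hg : g ∈ Ideal.span (Set.range (axialBinomial R x α e))) (i : ι) :
    Polynomial.X ^ α i ∣ toAxis R (x i) g := by
  classical
  refine dvd_toAxis_of_mem_span (Set.forall_mem_range.2 fun j => ?_) hg
  rw [toAxis_axialBinomial hx hα he]
  split_ifs
  exacts [dvd_rfl, dvd_zero _]

theorem minGenerators_span_axialBinomial [Nontrivial R] [Fintype ι] (hx : Function.Injective x)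
    (hα : ∀ j, α j ≠ 0) (he : ∀ i j, ∃ l, l ≠ x i ∧ e j l ≠ 0) :
    minGenerators (Ideal.span (Set.range (axialBinomial R x α e))) = Fintype.card ι := by
  classical
  have hfin := Set.finite_range (axialBinomial R x α e)
  refine le_antisymm ?_ (card_le_minGenerators (Submodule.fg_span hfin)
    (fun g => X_pow_dvd_toAxis_of_mem_span_axialBinomial hx hα he)
    (fun j => Ideal.subset_span ⟨j, rfl⟩) fun i j => ?_)
  · calc minGenerators (Ideal.span (Set.range (axialBinomial R x α e)))
        ≤ (Set.range (axialBinomial R x α e)).ncard :=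
          Submodule.spanFinrank_span_le_ncard_of_finite hfin
      _ ≤ Fintype.card ι := by
          rw [← Nat.card_coe_set_eq, ← Nat.card_eq_fintype_card]
          exact Finite.card_range_le _
  · rw [toAxis_axialBinomial hx hα he, apply_ite (Polynomial.coeff · (α i)),
      Polynomial.coeff_X_pow_self, Polynomial.coeff_zero]

end AxialBinomials

section Generators

open scoped Matrix

variable {k : Type*} [Field k] {m : ℕ} {s : Fin m → ℕ}

theorem definingIdeal_eq_span_axialBinomial {ι : Type*} {x : ι → Fin m} {α : ι → ℕ}
    {e : ι → Fin m → ℕ} (hs : ∀ j, α j * s (x j) = e j ⬝ᵥ s) {w : Fin m → ℕ}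
    (hw : ∀ j, e j ⬝ᵥ w < α j * w (x j))
    (hinj : Set.InjOn (· ⬝ᵥ s) {a | ∀ j, a (x j) < α j}) :
    definingIdeal k s = Ideal.span (Set.range (axialBinomial k x α e)) := by
  refine definingIdeal_eq_span_range_of_injOn (u := fun j => Pi.single (x j) (α j)) (v := e)
    (fun j => .inl (by rw [expMonomial_single, axialBinomial]))
    (fun j => by rw [single_dotProduct, hs]) (w := w)
    (fun j => by rw [single_dotProduct]; exact hw j) (hinj.mono ?_)
  intro a ha j
  by_contra! hle
  exact ha j (update_le_iff.2 ⟨hle, fun _ _ => Nat.zero_le _⟩)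

lemma exists_dotProduct_eq_of_mem_closure {i : Fin m} {N : ℕ}
    (hN : N ∈ AddSubmonoid.closure (s '' {l | l ≠ i})) : ∃ e : Fin m → ℕ, e i = 0 ∧ e ⬝ᵥ s = N := by
  induction hN using AddSubmonoid.closure_induction with
  | mem N hN =>
    obtain ⟨l, hl, rfl⟩ := hN
    exact ⟨Pi.single l 1, Pi.single_eq_of_ne hl.symm 1, by rw [single_one_dotProduct]⟩
  | zero => exact ⟨0, rfl, zero_dotProduct s⟩
  | add _ _ _ _ ih ih' =>
    obtain ⟨e, he, rfl⟩ := ih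
    obtain ⟨e', he', rfl⟩ := ih'
    exact ⟨e + e', by rw [Pi.add_apply, he, he'], add_dotProduct e e' s⟩

lemma dotProduct_mem_closure {i : Fin m} {e : Fin m → ℕ} (he : e i = 0) :
    e ⬝ᵥ s ∈ AddSubmonoid.closure (s '' {l | l ≠ i}) := by
  refine sum_mem fun l _ => ?_
  rcases eq_or_ne l i with rfl | hl
  · rw [he, zero_mul]
    exact zero_mem _
  · rw [← smul_eq_mul]
    exact nsmul_mem (AddSubmonoid.subset_closure (Set.mem_image_of_mem s hl)) _

theorem isCriticalBinomial_of_X_pow_dvd_toAxis {i : Fin m} (hsi : 0 < s i) {α : ℕ} (hα : 0 < α)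
    (hdvd : ∀ g ∈ definingIdeal k s, Polynomial.X ^ α ∣ toAxis k i g) {e : Fin m → ℕ}
    (he : e i = 0) (hmem : X i ^ α - expMonomial k e ∈ definingIdeal k s) :
    IsCriticalBinomial k s i (X i ^ α - expMonomial k e) := by
  refine ⟨hmem, α, e, ?_, ⟨hα, ?_⟩, ?_⟩
  · rw [expMonomial, Finset.prod_erase Finset.univ (by rw [he, pow_zero])]
  · rw [← expMonomial_single, expMonomial_sub_mem_definingIdeal_iff, single_dotProduct] at hmem
    rw [hmem]
    exact dotProduct_mem_closure he
  · rintro q ⟨hq, hqs⟩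
    obtain ⟨e', he', hweight⟩ := exists_dotProduct_eq_of_mem_closure hqs
    obtain ⟨l, -, hl⟩ : ∃ l ∈ Finset.univ, e' l * s l ≠ 0 :=
      Finset.exists_ne_zero_of_sum_ne_zero (hweight.trans_ne (Nat.mul_pos hq hsi).ne')
    have he'l : e' l ≠ 0 := left_ne_zero_of_mul hl
    have hli : l ≠ i := by
      rintro rfl
      exact he'l he'
    have hX : X i ^ q - expMonomial k e' ∈ definingIdeal k s := by
      rw [← expMonomial_single, expMonomial_sub_mem_definingIdeal_iff, single_dotProduct, hweight]
    have hdvdX := hdvd _ hX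
    rw [map_sub, toAxis_expMonomial_of_ne hli he'l, sub_zero, map_pow, toAxis_X_self] at hdvdX
    exact (pow_dvd_pow_iff Polynomial.X_ne_zero Polynomial.not_isUnit_X).1 hdvdX

/-- `f` is a minimal system of generators of `P_s` whose `i`-th member is critical with respect to
`x_i`. -/
structure IsMinimalCriticalSystem (k : Type*) [Field k] (s : Fin m → ℕ)
    (f : Fin m → MvPolynomial (Fin m) k) : Prop where
  isCriticalBinomial : ∀ i, IsCriticalBinomial k s i (f i)
  definingIdeal_eq : definingIdeal k s = Ideal.span (Set.range f)
  minGenerators_eq : minGenerators (definingIdeal k s) = m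

theorem isMinimalCriticalSystem_axialBinomial {α : Fin m → ℕ} {e : Fin m → Fin m → ℕ}
    (hs : ∀ i, 0 < s i) (hα : ∀ i, 0 < α i) (hei : ∀ i, e i i = 0)
    (he : ∀ i j, ∃ l, l ≠ i ∧ e j l ≠ 0)
    (hP : definingIdeal k s = Ideal.span (Set.range (axialBinomial k id α e))) :
    IsMinimalCriticalSystem k s (axialBinomial k id α e) := by
  have hx : Function.Injective (id : Fin m → Fin m) := Function.injective_id
  have hα₀ : ∀ i, α i ≠ 0 := fun i => (hα i).ne'
  refine ⟨fun i => isCriticalBinomial_of_X_pow_dvd_toAxis (hs i) (hα i) (fun g hg => ?_) (hei i) ?_,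
    hP, ?_⟩
  · rw [hP] at hg
    exact X_pow_dvd_toAxis_of_mem_span_axialBinomial hx hα₀ he hg i
  · rw [hP]
    exact Ideal.subset_span ⟨i, rfl⟩
  · rw [hP, minGenerators_span_axialBinomial hx hα₀ he, Fintype.card_fin]

end Generators

section Arithmetic

lemma eq_and_eq_of_mul_add_mul_eq {A D x x' N N' : ℕ} (hco : A.Coprime D) (hx : x < D)
    (hx' : x' < D) (h : x * A + D * N = x' * A + D * N') : x = x' ∧ N = N' := by
  have hmod : x * A ≡ x' * A [MOD D] := by
    rw [Nat.ModEq, ← Nat.add_mul_mod_self_left, h, Nat.add_mul_mod_self_left]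
  obtain rfl : x = x' :=
    (Nat.ModEq.cancel_right_of_coprime hco.symm hmod).eq_of_lt_of_lt hx hx'
  exact ⟨rfl, Nat.eq_of_mul_eq_mul_left (Nat.zero_lt_of_lt hx) (Nat.add_left_cancel h)⟩

/-- The L-shaped region of lattice points left after deleting the corner of size `a₂ × b₂` from
the rectangle of size `a₁ × b₁`: the exponents of the standard monomials in two variables for the
leading exponents `(a₁, 0)`, `(0, b₁)` and `(a₁ - a₂, b₁ - b₂)`. -/
def lShape (a₁ a₂ b₁ b₂ : ℤ) : Set (ℤ × ℤ) :=
  {z | 0 ≤ z.1 ∧ z.1 < a₁ ∧ 0 ≤ z.2 ∧ z.2 < b₁ ∧ (z.1 < a₁ - a₂ ∨ z.2 < b₁ - b₂)}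

variable {a₁ a₂ b₁ b₂ i j x y x' y' : ℤ}

lemma coeff_nonpos_of_mem_lShape (ha₂ : 0 ≤ a₂) (ha : a₂ ≤ a₁) (hb₂ : 0 ≤ b₂) (hb : b₂ ≤ b₁)
    (h : (x, y) ∈ lShape a₁ a₂ b₁ b₂) (h' : (x', y') ∈ lShape a₁ a₂ b₁ b₂)
    (hx : x - x' = i * a₁ - j * a₂) (hy : y - y' = j * b₁ - i * b₂) : i ≤ 0 := by
  obtain ⟨-, hxa, -, hyb, hcorner⟩ := h
  obtain ⟨hx', -, hy', -, -⟩ := h'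
  dsimp only at hxa hyb hcorner hx' hy'
  by_contra! hi
  rcases lt_trichotomy j i with hji | rfl | hij
  · have hle : a₁ ≤ x - x' := by
      nlinarith [mul_nonneg (sub_nonneg.2 (Int.add_one_le_iff.2 hji)) ha₂]
    linarith
  · have hxle : a₁ - a₂ ≤ x - x' := by nlinarith
    have hyle : b₁ - b₂ ≤ y - y' := by nlinarith
    rcases hcorner with hxc | hyc <;> linarith
  · have hle : b₁ ≤ y - y' := by
      nlinarith [mul_nonneg (sub_nonneg.2 (Int.add_one_le_iff.2 hij)) (sub_nonneg.2 hb)]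
    linarith

/-- Distinct points of `lShape` are incongruent modulo the lattice spanned by `(a₁, -b₂)` and
`(-a₂, b₁)`. -/
lemma eq_and_eq_of_mem_lShape (ha₂ : 0 ≤ a₂) (ha : a₂ ≤ a₁) (hb₂ : 0 ≤ b₂) (hb : b₂ ≤ b₁)
    (h : (x, y) ∈ lShape a₁ a₂ b₁ b₂) (h' : (x', y') ∈ lShape a₁ a₂ b₁ b₂)
    (hx : x - x' = i * a₁ - j * a₂) (hy : y - y' = j * b₁ - i * b₂) : x = x' ∧ y = y' := by
  have hi : i ≤ 0 := coeff_nonpos_of_mem_lShape ha₂ ha hb₂ hb h h' hx hy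
  have hi' : -i ≤ 0 := coeff_nonpos_of_mem_lShape (j := -j) ha₂ ha hb₂ hb h' h
    (by linear_combination -hx) (by linear_combination -hy)
  obtain rfl : i = 0 := by omega
  obtain ⟨-, -, hy₀, hyb, -⟩ := h
  obtain ⟨-, -, hy₀', hyb', -⟩ := h'
  dsimp only at hy₀ hyb hy₀' hyb'
  obtain rfl : j = 0 := by
    have hj : j < 1 := by nlinarith
    have hj' : -1 < j := by nlinarith
    omega
  exact ⟨by linarith, by linarith⟩

end Arithmetic

section Injectivity

open scoped Matrix

variable {p n t : ℕ}

lemma dotProduct_translatedSeq_left (A B p M : ℕ) (e : Fin 4 → ℕ) :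
    e ⬝ᵥ translatedSeq A B (p * (A + B)) ((A + B) * M) =
      e 1 * A + (A + B) * ((e 0 + e 1 + e 2 + e 3) * M + e 2 + (p + 1) * e 3) := by
  simp only [dotProduct, Fin.sum_univ_four, translatedSeq, Matrix.cons_val]
  ring

lemma dotProduct_translatedSeq_right (B C p M : ℕ) (e : Fin 4 → ℕ) :
    e ⬝ᵥ translatedSeq (p * (B + C)) B C ((B + C) * M) =
      e 2 * B + (B + C) * ((e 0 + e 1 + e 2 + e 3) * M + p * (e 1 + e 2) + (p + 1) * e 3) := by
  simp only [dotProduct, Fin.sum_univ_four, translatedSeq, Matrix.cons_val]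
  ring

lemma ext_fin_four {e e' : Fin 4 → ℕ} (h0 : e 0 = e' 0) (h1 : e 1 = e' 1) (h2 : e 2 = e' 2)
    (h3 : e 3 = e' 3) : e = e' :=
  funext fun i => by fin_cases i <;> assumption

lemma injOn_dotProduct_left {A B : ℕ} (hco : A.Coprime B) :
    Set.InjOn (· ⬝ᵥ translatedSeq A B (p * (A + B)) ((A + B) * ((p + 1) * n)))
      {e | e 0 < n + 1 ∧ e 2 < p + 1 ∧ e 1 < A + B} := by
  rintro e ⟨h0, h2, h1⟩ e' ⟨h0', h2', h1'⟩ h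
  simp only [dotProduct_translatedSeq_left] at h
  obtain ⟨he1, hN⟩ := eq_and_eq_of_mul_add_mul_eq (Nat.coprime_self_add_right.2 hco) h1 h1' h
  rw [he1] at hN
  obtain ⟨he2, hQ⟩ := eq_and_eq_of_mul_add_mul_eq (Nat.coprime_one_left (p + 1)) h2 h2'
    (N := (e 0 + e' 1 + e 2 + e 3) * n + e 3) (N' := (e' 0 + e' 1 + e' 2 + e' 3) * n + e' 3)
    (by linarith)
  rw [he2] at hQ
  obtain ⟨he0, he3⟩ := eq_and_eq_of_mul_add_mul_eq (by simp : n.Coprime (n + 1)) h0 h0'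
    (N := e 3) (N' := e' 3) (by linarith)
  exact ext_fin_four he0 he1 he2 he3

lemma injOn_dotProduct_right {B C : ℕ} (hco : B.Coprime C) :
    Set.InjOn (· ⬝ᵥ translatedSeq (p * (B + C)) B C ((B + C) * ((p + 1) * n)))
      {e | e 0 < n + 1 ∧ e 1 < p + 1 ∧ e 2 < B + C} := by
  rintro e ⟨h0, h1, h2⟩ e' ⟨h0', h1', h2'⟩ h
  simp only [dotProduct_translatedSeq_right] at h
  obtain ⟨he2, hN⟩ := eq_and_eq_of_mul_add_mul_eq (Nat.coprime_self_add_right.2 hco) h2 h2' h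
  rw [he2] at hN
  obtain ⟨he1, hQ⟩ := eq_and_eq_of_mul_add_mul_eq (by simp : p.Coprime (p + 1)) h1 h1'
    (N := (e 0 + e 1 + e' 2 + e 3) * n + e 3) (N' := (e' 0 + e' 1 + e' 2 + e' 3) * n + e' 3)
    (by linarith)
  rw [he1] at hQ
  obtain ⟨he0, he3⟩ := eq_and_eq_of_mul_add_mul_eq (by simp : n.Coprime (n + 1)) h0 h0'
    (N := e 3) (N' := e' 3) (by linarith)
  exact ext_fin_four he0 he1 he2 he3

lemma injOn_dotProduct_left_shift {A B : ℕ} (hco : A.Coprime B) (ht : t ≤ p) (hn : 0 < n) :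
    Set.InjOn (· ⬝ᵥ translatedSeq A B (p * (A + B)) ((A + B) * ((p + 1) * n + t)))
      {e | (e 2 < t ∨ e 3 < n) ∧ e 1 < A + B ∧ e 2 < p + 1 ∧ e 3 < n + 1} := by
  rintro e ⟨h23, h1, h2, h3⟩ e' ⟨h23', h1', h2', h3'⟩ h
  simp only [dotProduct_translatedSeq_left] at h
  obtain ⟨he1, hN⟩ := eq_and_eq_of_mul_add_mul_eq (Nat.coprime_self_add_right.2 hco) h1 h1' h
  rw [he1] at hN
  zify at hN
  have hL : ((e 2, e 3) : ℤ × ℤ) ∈ lShape (p + 1) (p + 1 - t) (n + 1) 1 := by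
    simp only [lShape, Set.mem_ofPred_eq]
    omega
  have hL' : ((e' 2, e' 3) : ℤ × ℤ) ∈ lShape (p + 1) (p + 1 - t) (n + 1) 1 := by
    simp only [lShape, Set.mem_ofPred_eq]
    omega
  set S : ℤ := e 0 + e 2 + e 3 - (e' 0 + e' 2 + e' 3)
  obtain ⟨he2, he3⟩ := eq_and_eq_of_mem_lShape (i := e' 3 - e 3 - S * (n + 1)) (j := -S)
    (by omega) (by omega) (by omega) (by omega) hL hL' (by linear_combination hN) (by ring)
  have hmul : S * ((p + 1) * n + t) = 0 := by linear_combination hN - he2 - (p + 1) * he3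
  have hS : S = 0 := (mul_eq_zero.1 hmul).resolve_right (by positivity)
  exact ext_fin_four (by omega) he1 (by omega) (by omega)

lemma injOn_dotProduct_right_shift {B C : ℕ} (hco : B.Coprime C) (ht : 0 < t) (htp : t ≤ p)
    (hpn : p < n + t) :
    Set.InjOn (· ⬝ᵥ translatedSeq (p * (B + C)) B C ((B + C) * ((p + 1) * n + t)))
      {e | (e 1 < p + 1 - t ∨ e 3 < n + t - p) ∧ e 1 < p + 1 ∧ e 2 < B + C ∧ e 3 < n + t} := by
  rintro e ⟨h13, h1, h2, h3⟩ e' ⟨h13', h1', h2', h3'⟩ h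
  simp only [dotProduct_translatedSeq_right] at h
  obtain ⟨he2, hN⟩ := eq_and_eq_of_mul_add_mul_eq (Nat.coprime_self_add_right.2 hco) h2 h2' h
  rw [he2] at hN
  zify at hN
  have hL : ((e 1, e 3) : ℤ × ℤ) ∈ lShape (p + 1) t (n + t) p := by
    simp only [lShape, Set.mem_ofPred_eq]
    omega
  have hL' : ((e' 1, e' 3) : ℤ × ℤ) ∈ lShape (p + 1) t (n + t) p := by
    simp only [lShape, Set.mem_ofPred_eq]
    omega
  set S : ℤ := e 0 + e 1 + e 3 - (e' 0 + e' 1 + e' 3)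
  obtain ⟨he1, he3⟩ := eq_and_eq_of_mem_lShape (i := e 1 - e' 1 + (e 3 - e' 3) + S * n) (j := -S)
    (by omega) (by omega) (by omega) (by omega) hL hL' (by linear_combination -hN)
    (by linear_combination hN)
  have hmul : S * ((p + 1) * n + t) = 0 := by
    linear_combination hN - p * he1 - (p + 1) * he3
  have hS : S = 0 := (mul_eq_zero.1 hmul).resolve_right (by positivity)
  exact ext_fin_four (by omega) (by omega) he2 (by omega)

end Injectivity

section TranslatedSequences

variable {k : Type*} [Field k] {A B C a b c p n t j : ℕ}

lemma translatedSeq_pos (hj : 0 < j) (i : Fin 4) : 0 < translatedSeq a b c j i := by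
  fin_cases i <;> simp [translatedSeq, hj]

lemma translatedSeq_mul (d a b c j : ℕ) :
    translatedSeq (d * a) (d * b) (d * c) (d * j) = d • translatedSeq a b c j := by
  simp only [translatedSeq, ← mul_add, Matrix.smul_cons, Matrix.smul_empty, smul_eq_mul]

lemma definingIdeal_translatedSeq_left (ha : 0 < a) (b p M : ℕ) :
    definingIdeal k (translatedSeq a b (p * (a + b)) ((a + b) * M)) =
      definingIdeal k (translatedSeq (a / a.gcd b) (b / a.gcd b) (p * (a / a.gcd b + b / a.gcd b))
        ((a / a.gcd b + b / a.gcd b) * M)) := by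
  have hd : 0 < a.gcd b := Nat.gcd_pos_of_pos_left b ha
  rw [← definingIdeal_smul hd (s := translatedSeq (a / a.gcd b) _ _ _), ← translatedSeq_mul,
    mul_left_comm, ← mul_assoc (a.gcd b), mul_add (a.gcd b),
    Nat.mul_div_cancel' (Nat.gcd_dvd_left a b), Nat.mul_div_cancel' (Nat.gcd_dvd_right a b)]

lemma definingIdeal_translatedSeq_right (hb : 0 < b) (c p M : ℕ) :
    definingIdeal k (translatedSeq (p * (b + c)) b c ((b + c) * M)) =
      definingIdeal k (translatedSeq (p * (b / b.gcd c + c / b.gcd c)) (b / b.gcd c) (c / b.gcd c)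
        ((b / b.gcd c + c / b.gcd c) * M)) := by
  have hd : 0 < b.gcd c := Nat.gcd_pos_of_pos_left c hb
  rw [← definingIdeal_smul hd (s := translatedSeq _ (b / b.gcd c) _ _), ← translatedSeq_mul,
    mul_left_comm, ← mul_assoc (b.gcd c), mul_add (b.gcd c),
    Nat.mul_div_cancel' (Nat.gcd_dvd_left b c), Nat.mul_div_cancel' (Nat.gcd_dvd_right b c)]

lemma vec_le_iff_fin_four {x₀ x₁ x₂ x₃ : ℕ} {e : Fin 4 → ℕ} :
    ![x₀, x₁, x₂, x₃] ≤ e ↔ x₀ ≤ e 0 ∧ x₁ ≤ e 1 ∧ x₂ ≤ e 2 ∧ x₃ ≤ e 3 := by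
  simp [Pi.le_def, Fin.forall_fin_succ]

theorem definingIdeal_eq_span_left_multiple (hco : A.Coprime B) (hAB : 0 < A + B) :
    definingIdeal k (translatedSeq A B (p * (A + B)) ((A + B) * ((p + 1) * n))) =
      Ideal.span (Set.range (axialBinomial k ![0, 2, 1] ![n + 1, p + 1, A + B]
        ![![0, 0, 0, n], ![p, 0, 0, 1], ![B, 0, A, 0]])) := by
  refine definingIdeal_eq_span_axialBinomial (w := ![1, 3, 2, 1]) ?_ ?_ ?_
  · intro i
    fin_cases i <;>
      simp only [dotProduct, Fin.sum_univ_four, translatedSeq, Fin.zero_eta, Fin.mk_one,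
        Fin.reduceFinMk, Matrix.cons_val] <;>
      ring
  · intro i
    fin_cases i <;>
      simp only [dotProduct, Fin.sum_univ_four, Fin.zero_eta, Fin.mk_one, Fin.reduceFinMk,
        Matrix.cons_val] <;>
      omega
  · refine (injOn_dotProduct_left hco).mono fun e he => ?_
    simpa [Fin.forall_fin_succ] using he

theorem definingIdeal_eq_span_right_multiple (hco : B.Coprime C) (hBC : 0 < B + C) :
    definingIdeal k (translatedSeq (p * (B + C)) B C ((B + C) * ((p + 1) * n))) =
      Ideal.span (Set.range (axialBinomial k ![0, 1, 2] ![n + 1, p + 1, B + C]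
        ![![0, 0, 0, n], ![1, 0, 0, p], ![0, C, 0, B]])) := by
  refine definingIdeal_eq_span_axialBinomial (w := ![1, 2, 3, 1]) ?_ ?_ ?_
  · intro i
    fin_cases i <;>
      simp only [dotProduct, Fin.sum_univ_four, translatedSeq, Fin.zero_eta, Fin.mk_one,
        Fin.reduceFinMk, Matrix.cons_val] <;>
      ring
  · intro i
    fin_cases i <;>
      simp only [dotProduct, Fin.sum_univ_four, Fin.zero_eta, Fin.mk_one, Fin.reduceFinMk,
        Matrix.cons_val] <;>
      omega
  · refine (injOn_dotProduct_right hco).mono fun e he => ?_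
    simpa [Fin.forall_fin_succ] using he

theorem definingIdeal_eq_span_left_shift (hco : A.Coprime B) (hAB : 0 < A + B) (hp : 0 < p)
    (htp : t ≤ p) (hn : 0 < n) (hpn : p ≤ n + t) :
    definingIdeal k (translatedSeq A B (p * (A + B)) ((A + B) * ((p + 1) * n + t))) =
      Ideal.span (Set.range (axialBinomial k id ![n + t + 1, A + B, p + 1, n + 1]
        ![![0, 0, t, n], ![B, 0, A, 0], ![p, 0, 0, 1], ![n + t - p + 1, 0, p - t + 1, 0]])) := by
  refine definingIdeal_eq_span_range_of_injOn (w := ![0, 3, 2, 3])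
    (u := ![![0, 0, t, n], ![0, A + B, 0, 0], ![0, 0, p + 1, 0], ![0, 0, 0, n + 1]])
    (v := ![![n + t + 1, 0, 0, 0], ![B, 0, A, 0], ![p, 0, 0, 1], ![n + t - p + 1, 0, p - t + 1, 0]])
    ?_ ?_ ?_ ?_
  · intro i
    fin_cases i <;> simp [axialBinomial, expMonomial_fin_four]
  · obtain ⟨q, rfl⟩ := Nat.exists_eq_add_of_le htp
    obtain ⟨r, rfl⟩ : ∃ r, n = q + r := Nat.exists_eq_add_of_le (by omega)
    rw [show q + r + t - (t + q) = r by omega, Nat.add_sub_cancel_left]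
    intro i
    fin_cases i <;>
      simp only [dotProduct, Fin.sum_univ_four, translatedSeq, Fin.zero_eta, Fin.mk_one,
        Fin.reduceFinMk, Matrix.cons_val] <;>
      ring
  · intro i
    fin_cases i <;>
      simp only [dotProduct, Fin.sum_univ_four, Fin.zero_eta, Fin.mk_one, Fin.reduceFinMk,
        Matrix.cons_val] <;>
      omega
  · refine (injOn_dotProduct_left_shift hco htp hn).mono fun e he => ?_
    have he₀ := he 0
    have he₁ := he 1
    have he₂ := he 2
    have he₃ := he 3
    simp only [vec_le_iff_fin_four, Matrix.cons_val, Set.mem_ofPred_eq] at he₀ he₁ he₂ he₃ ⊢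
    omega

theorem definingIdeal_eq_span_right_shift (hco : B.Coprime C) (hBC : 0 < B + C) (ht : 0 < t)
    (htp : t ≤ p) (hpn : p < n + t) :
    definingIdeal k (translatedSeq (p * (B + C)) B C ((B + C) * ((p + 1) * n + t))) =
      Ideal.span (Set.range (axialBinomial k id ![n + 2, p + 1, B + C, n + t]
        ![![0, p + 1 - t, 0, n + t - p], ![1, 0, 0, p], ![0, C, 0, B], ![n + 1, t, 0, 0]])) := by
  refine definingIdeal_eq_span_range_of_injOn (w := ![0, 1, 2, 1])
    (u := ![![0, p + 1 - t, 0, n + t - p], ![0, p + 1, 0, 0], ![0, 0, B + C, 0], ![0, 0, 0, n + t]])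
    (v := ![![n + 2, 0, 0, 0], ![1, 0, 0, p], ![0, C, 0, B], ![n + 1, t, 0, 0]])
    ?_ ?_ ?_ ?_
  · intro i
    fin_cases i <;> simp [axialBinomial, expMonomial_fin_four]
  · obtain ⟨q, rfl⟩ := Nat.exists_eq_add_of_le htp
    obtain ⟨r, rfl⟩ : ∃ r, n = q + 1 + r := Nat.exists_eq_add_of_le (by omega)
    rw [show q + 1 + r + t - (t + q) = r + 1 by omega, show t + q + 1 - t = q + 1 by omega]
    intro i
    fin_cases i <;>
      simp only [dotProduct, Fin.sum_univ_four, translatedSeq, Fin.zero_eta, Fin.mk_one,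
        Fin.reduceFinMk, Matrix.cons_val] <;>
      ring
  · intro i
    fin_cases i <;>
      simp only [dotProduct, Fin.sum_univ_four, Fin.zero_eta, Fin.mk_one, Fin.reduceFinMk,
        Matrix.cons_val] <;>
      omega
  · refine (injOn_dotProduct_right_shift hco ht htp hpn).mono fun e he => ?_
    have he₀ := he 0
    have he₁ := he 1
    have he₂ := he 2
    have he₃ := he 3
    simp only [vec_le_iff_fin_four, Matrix.cons_val, Set.mem_ofPred_eq] at he₀ he₁ he₂ he₃ ⊢
    omega

end TranslatedSequences

section MainCases

variable {k : Type*} [Field k] {a b c p n t j : ℕ}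

theorem definingIdeal_eq_and_minGenerators_eq_left_multiple (ha : 0 < a) (hb : 0 < b)
    (hn : 0 < n) (hc : c = p * (a + b)) (hj : j = (a + b + c) * n) :
    definingIdeal k (translatedSeq a b c j) =
        Ideal.span {X 0 ^ (n + 1) - X 3 ^ n,
          X 2 ^ (p + 1) - X 0 ^ p * X 3,
          X 1 ^ ((a + b) / a.gcd b) - X 0 ^ (b / a.gcd b) * X 2 ^ (a / a.gcd b)} ∧
      minGenerators (definingIdeal k (translatedSeq a b c j)) = 3 := by
  have hA : 0 < a / a.gcd b := Nat.div_gcd_pos_of_pos_left b ha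
  have hB : 0 < b / a.gcd b := Nat.div_gcd_pos_of_pos_right a hb
  have hco := Nat.coprime_div_gcd_div_gcd (Nat.gcd_pos_of_pos_left b ha)
  obtain rfl : j = (a + b) * ((p + 1) * n) := by rw [hj, hc]; ring
  rw [hc, definingIdeal_translatedSeq_left ha,
    definingIdeal_eq_span_left_multiple hco (by positivity),
    Nat.add_div_of_dvd_right (Nat.gcd_dvd_left a b)]
  constructor
  · congr 1
    ext g
    simp [Fin.exists_fin_succ, axialBinomial, expMonomial_fin_four, eq_comm]
  · refine minGenerators_span_axialBinomial (by decide) (fun i => ?_) fun i j => ?_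
    · fin_cases i <;> simp [hA.ne']
    · fin_cases i <;> fin_cases j <;> simp [Fin.exists_fin_succ, hn.ne', hA.ne', hB.ne']

theorem definingIdeal_eq_and_minGenerators_eq_right_multiple (hb : 0 < b) (hc : 0 < c)
    (hp : 0 < p) (hn : 0 < n) (ha : a = p * (b + c)) (hj : j = (a + b + c) * n) :
    definingIdeal k (translatedSeq a b c j) =
        Ideal.span {X 0 ^ (n + 1) - X 3 ^ n,
          X 1 ^ (p + 1) - X 0 * X 3 ^ p,
          X 2 ^ ((b + c) / b.gcd c) - X 1 ^ (c / b.gcd c) * X 3 ^ (b / b.gcd c)} ∧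
      minGenerators (definingIdeal k (translatedSeq a b c j)) = 3 := by
  have hB : 0 < b / b.gcd c := Nat.div_gcd_pos_of_pos_left c hb
  have hC : 0 < c / b.gcd c := Nat.div_gcd_pos_of_pos_right b hc
  have hco := Nat.coprime_div_gcd_div_gcd (Nat.gcd_pos_of_pos_left c hb)
  obtain rfl : j = (b + c) * ((p + 1) * n) := by rw [hj, ha]; ring
  rw [ha, definingIdeal_translatedSeq_right hb,
    definingIdeal_eq_span_right_multiple hco (by positivity),
    Nat.add_div_of_dvd_right (Nat.gcd_dvd_left b c)]
  constructor
  · congr 1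
    ext g
    simp [Fin.exists_fin_succ, axialBinomial, expMonomial_fin_four, eq_comm]
  · refine minGenerators_span_axialBinomial (by decide) (fun i => ?_) fun i j => ?_
    · fin_cases i <;> simp [hB.ne']
    · fin_cases i <;> fin_cases j <;>
        simp [Fin.exists_fin_succ, hn.ne', hp.ne', hB.ne', hC.ne']

theorem isMinimalCriticalSystem_left_shift (ha : 0 < a) (hb : 0 < b) (ht : 0 < t) (htp : t ≤ p)
    (hn : 0 < n) (hpn : p ≤ n + t) (hc : c = p * (a + b))
    (hj : j = (a + b + c) * n + (a + b) * t) :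
    IsMinimalCriticalSystem k (translatedSeq a b c j)
      ![X 0 ^ (n + t + 1) - X 2 ^ t * X 3 ^ n,
        X 1 ^ ((a + b) / a.gcd b) - X 0 ^ (b / a.gcd b) * X 2 ^ (a / a.gcd b),
        X 2 ^ (p + 1) - X 0 ^ p * X 3,
        X 3 ^ (n + 1) - X 0 ^ (n + t - p + 1) * X 2 ^ (p - t + 1)] := by
  have hA : 0 < a / a.gcd b := Nat.div_gcd_pos_of_pos_left b ha
  have hB : 0 < b / a.gcd b := Nat.div_gcd_pos_of_pos_right a hb
  have hco := Nat.coprime_div_gcd_div_gcd (Nat.gcd_pos_of_pos_left b ha)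
  have hp : 0 < p := ht.trans_le htp
  obtain rfl : j = (a + b) * ((p + 1) * n + t) := by rw [hj, hc]; ring
  have hP := definingIdeal_translatedSeq_left (k := k) ha b p ((p + 1) * n + t)
  rw [definingIdeal_eq_span_left_shift hco (by positivity) hp htp hn hpn] at hP
  rw [hc, Nat.add_div_of_dvd_right (Nat.gcd_dvd_left a b)]
  convert isMinimalCriticalSystem_axialBinomial (translatedSeq_pos (by positivity)) (fun i => ?_)
    (fun i => ?_) (fun i j => ?_) hP using 1
  · funext i
    fin_cases i <;> simp [axialBinomial, expMonomial_fin_four]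
  · fin_cases i <;> simp [hA]
  · fin_cases i <;> rfl
  · fin_cases i <;> fin_cases j <;>
      simp [Fin.exists_fin_succ, hn.ne', hA.ne', hB.ne', hp.ne', ht.ne']

theorem isMinimalCriticalSystem_right_shift (hb : 0 < b) (hc : 0 < c) (ht : 0 < t) (htp : t ≤ p)
    (hpn : p < n + t) (ha : a = p * (b + c)) (hj : j = (a + b + c) * n + (b + c) * t) :
    IsMinimalCriticalSystem k (translatedSeq a b c j)
      ![X 0 ^ (n + 2) - X 1 ^ (p + 1 - t) * X 3 ^ (n + t - p),
        X 1 ^ (p + 1) - X 0 * X 3 ^ p,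
        X 2 ^ ((b + c) / b.gcd c) - X 1 ^ (c / b.gcd c) * X 3 ^ (b / b.gcd c),
        X 3 ^ (n + t) - X 0 ^ (n + 1) * X 1 ^ t] := by
  have hB : 0 < b / b.gcd c := Nat.div_gcd_pos_of_pos_left c hb
  have hC : 0 < c / b.gcd c := Nat.div_gcd_pos_of_pos_right b hc
  have hco := Nat.coprime_div_gcd_div_gcd (Nat.gcd_pos_of_pos_left c hb)
  have hp : 0 < p := ht.trans_le htp
  have hpt : p + 1 - t ≠ 0 := by omega
  have hnt : n + t - p ≠ 0 := by omega
  obtain rfl : j = (b + c) * ((p + 1) * n + t) := by rw [hj, ha]; ring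
  have hP := definingIdeal_translatedSeq_right (k := k) hb c p ((p + 1) * n + t)
  rw [definingIdeal_eq_span_right_shift hco (by positivity) ht htp hpn] at hP
  rw [ha, Nat.add_div_of_dvd_right (Nat.gcd_dvd_left b c)]
  convert isMinimalCriticalSystem_axialBinomial (translatedSeq_pos (by positivity)) (fun i => ?_)
    (fun i => ?_) (fun i j => ?_) hP using 1
  · funext i
    fin_cases i <;> simp [axialBinomial, expMonomial_fin_four]
  · fin_cases i <;> simp [hB, ht]
  · fin_cases i <;> rfl
  · fin_cases i <;> fin_cases j <;>
      simp only [Fin.exists_fin_succ] <;> simp [hpt, hnt, hB.ne', hC.ne', hp.ne', ht.ne']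

end MainCases

theorem theoremA_general (k : Type*) [Field k] (a b c p n t j : ℕ)
    (ha : 0 < a) (hb : 0 < b) (hc : 0 < c) (hj : 1 ≤ j) :
    (c = p * (a + b) → j = (a + b + c) * n →
      definingIdeal k (translatedSeq a b c j) =
          Ideal.span {X 0 ^ (n + 1) - X 3 ^ n,
            X 2 ^ (p + 1) - X 0 ^ p * X 3,
            X 1 ^ ((a + b) / a.gcd b) - X 0 ^ (b / a.gcd b) * X 2 ^ (a / a.gcd b)} ∧
        minGenerators (definingIdeal k (translatedSeq a b c j)) = 3) ∧
    (a = p * (b + c) → j = (a + b + c) * n →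
      definingIdeal k (translatedSeq a b c j) =
          Ideal.span {X 0 ^ (n + 1) - X 3 ^ n,
            X 1 ^ (p + 1) - X 0 * X 3 ^ p,
            X 2 ^ ((b + c) / b.gcd c) - X 1 ^ (c / b.gcd c) * X 3 ^ (b / b.gcd c)} ∧
        minGenerators (definingIdeal k (translatedSeq a b c j)) = 3) ∧
    (c = p * (a + b) → 1 ≤ t → t ≤ p → 1 ≤ n → p ≤ n + t →
      j = (a + b + c) * n + (a + b) * t →
      ∃ f : Fin 4 → MvPolynomial (Fin 4) k,
        f = ![X 0 ^ (n + t + 1) - X 2 ^ t * X 3 ^ n,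
          X 1 ^ ((a + b) / a.gcd b) - X 0 ^ (b / a.gcd b) * X 2 ^ (a / a.gcd b),
          X 2 ^ (p + 1) - X 0 ^ p * X 3,
          X 3 ^ (n + 1) - X 0 ^ (n + t - p + 1) * X 2 ^ (p - t + 1)] ∧
        (∀ i, IsCriticalBinomial k (translatedSeq a b c j) i (f i)) ∧
        definingIdeal k (translatedSeq a b c j) = Ideal.span (Set.range f) ∧
        minGenerators (definingIdeal k (translatedSeq a b c j)) = 4) ∧
    (a = p * (b + c) → 1 ≤ t → t ≤ p → p < n + t →
      j = (a + b + c) * n + (b + c) * t →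
      ∃ f : Fin 4 → MvPolynomial (Fin 4) k,
        f = ![X 0 ^ (n + 2) - X 1 ^ (p + 1 - t) * X 3 ^ (n + t - p),
          X 1 ^ (p + 1) - X 0 * X 3 ^ p,
          X 2 ^ ((b + c) / b.gcd c) - X 1 ^ (c / b.gcd c) * X 3 ^ (b / b.gcd c),
          X 3 ^ (n + t) - X 0 ^ (n + 1) * X 1 ^ t] ∧
        (∀ i, IsCriticalBinomial k (translatedSeq a b c j) i (f i)) ∧
        definingIdeal k (translatedSeq a b c j) = Ideal.span (Set.range f) ∧
        minGenerators (definingIdeal k (translatedSeq a b c j)) = 4) := by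
  refine ⟨fun hcp hjn => ?_, fun hap hjn => ?_, fun hcp ht htp hn hpn hjn => ?_,
    fun hap ht htp hpn hjn => ?_⟩
  · have hn : 0 < n := Nat.pos_of_mul_pos_left (hjn ▸ hj)
    exact definingIdeal_eq_and_minGenerators_eq_left_multiple ha hb hn hcp hjn
  · have hn : 0 < n := Nat.pos_of_mul_pos_left (hjn ▸ hj)
    have hp : 0 < p := Nat.pos_of_mul_pos_right (hap ▸ ha)
    exact definingIdeal_eq_and_minGenerators_eq_right_multiple hb hc hp hn hap hjn
  · have h := isMinimalCriticalSystem_left_shift (k := k) ha hb ht htp hn hpn hcp hjn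
    exact ⟨_, rfl, h.isCriticalBinomial, h.definingIdeal_eq, h.minGenerators_eq⟩
  · have h := isMinimalCriticalSystem_right_shift (k := k) hb hc ht htp hpn hap hjn
    exact ⟨_, rfl, h.isCriticalBinomial, h.definingIdeal_eq, h.minGenerators_eq⟩


theorem theoremA (k : Type*) [Field k] [CharZero k] (a b c p n t j : ℕ)
    (ha : 0 < a) (hb : 0 < b) (hc : 0 < c) (hj : 1 ≤ j) :
    -- `c = p (a + b)`, `j` a multiple of the period
    (c = p * (a + b) → j = (a + b + c) * n →
      definingIdeal k (translatedSeq a b c j) =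
          Ideal.span {X 0 ^ (n + 1) - X 3 ^ n,
            X 2 ^ (p + 1) - X 0 ^ p * X 3,
            X 1 ^ ((a + b) / a.gcd b) - X 0 ^ (b / a.gcd b) * X 2 ^ (a / a.gcd b)} ∧
        minGenerators (definingIdeal k (translatedSeq a b c j)) = 3) ∧
    -- `a = p (b + c)`, `j` a multiple of the period
    (a = p * (b + c) → j = (a + b + c) * n →
      definingIdeal k (translatedSeq a b c j) =
          Ideal.span {X 0 ^ (n + 1) - X 3 ^ n,
            X 1 ^ (p + 1) - X 0 * X 3 ^ p,
            X 2 ^ ((b + c) / b.gcd c) - X 1 ^ (c / b.gcd c) * X 3 ^ (b / b.gcd c)} ∧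
        minGenerators (definingIdeal k (translatedSeq a b c j)) = 3) ∧
    -- `c = p (a + b)`, `j` shifted by `(a + b) t`
    (c = p * (a + b) → 1 ≤ t → t ≤ p → 1 ≤ n → p ≤ n + t →
      j = (a + b + c) * n + (a + b) * t →
      ∃ f : Fin 4 → MvPolynomial (Fin 4) k,
        f = ![X 0 ^ (n + t + 1) - X 2 ^ t * X 3 ^ n,
          X 1 ^ ((a + b) / a.gcd b) - X 0 ^ (b / a.gcd b) * X 2 ^ (a / a.gcd b),
          X 2 ^ (p + 1) - X 0 ^ p * X 3,
          X 3 ^ (n + 1) - X 0 ^ (n + t - p + 1) * X 2 ^ (p - t + 1)] ∧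
        (∀ i, IsCriticalBinomial k (translatedSeq a b c j) i (f i)) ∧
        definingIdeal k (translatedSeq a b c j) = Ideal.span (Set.range f) ∧
        minGenerators (definingIdeal k (translatedSeq a b c j)) = 4) ∧
    -- `a = p (b + c)`, `j` shifted by `(b + c) t`
    (a = p * (b + c) → 1 ≤ t → t ≤ p → p < n + t →
      j = (a + b + c) * n + (b + c) * t →
      ∃ f : Fin 4 → MvPolynomial (Fin 4) k,
        f = ![X 0 ^ (n + 2) - X 1 ^ (p + 1 - t) * X 3 ^ (n + t - p),
          X 1 ^ (p + 1) - X 0 * X 3 ^ p,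
          X 2 ^ ((b + c) / b.gcd c) - X 1 ^ (c / b.gcd c) * X 3 ^ (b / b.gcd c),
          X 3 ^ (n + t) - X 0 ^ (n + 1) * X 1 ^ t] ∧
        (∀ i, IsCriticalBinomial k (translatedSeq a b c j) i (f i)) ∧
        definingIdeal k (translatedSeq a b c j) = Ideal.span (Set.range f) ∧
        minGenerators (definingIdeal k (translatedSeq a b c j)) = 4) := by
  exact theoremA_general k a b c p n t j ha hb hc hj
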